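/- Conventions. Let $(P,\le)$ be a nonempty partial order (or, more generally, a nonempty preorder). Elements $p,q\in P$ are incompatible ($p\perp q$) if no $r\in P$ satisfies $r\le p$ and $r\le q$. A set $D\subseteq P$ is dense if for every $p\in P$ there is $d\in D$ with $d\le p$. $P$ has the BT-property (base tree property) if it has a dense subset $D$, considered with the induced order, such that: $D$ is atomless (below every $d\in D$ there are $d_1,d_2\in D$ with $d_1\perp d_2$); $D$ is $\sigma$-closed (every countable decreasing sequence in $D$ has a lower bound in $D$); and $|D|\le\mathfrak c=2^{\aleph_0}$. A Boolean algebra $B$ has the BT-property if the partial order $B\setminus\{0\}$ has it. $\mathrm{RO}(P)$ is the complete Boolean algebra of regular open subsets of $P$, where the open sets are the downward closed sets. $\mathrm{Coll}(\omega_1,\mathfrak c)$ is the Boolean completion $\mathrm{RO}(T)$ of the complete binary tree of height $\omega_1$, $T=\bigcup_{\alpha<\omega_1}{}^{\alpha}\{0,1\}$, ordered by $s\le t$ iff $s\supseteq t$. A Boolean subalgebra $B$ of a Boolean algebra $C$ is regular if, whenever $S\subseteq B$ has a supremum in $B$, this element is also the supremum of $S$ in $C$. Theorem. (1) If $(P,\le)$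 has the BT-property, then $\mathrm{RO}(P)$ is isomorphic to a regular subalgebra of $\mathrm{Coll}(\omega_1,\mathfrak c)$. (2) Conversely, every regular subalgebra $B$ of $\mathrm{Coll}(\omega_1,\mathfrak c)$ which, as a Boolean algebra, is complete and atomless has the BT-property. -/

import Mathlib

open Cardinal
open scoped Ordinal

/-- `p` and `q` are incompatible (`p ⊥ q`): they have no common lower bound. -/
def Incompatible {P : Type*} [Preorder P] (p q : P) : Prop :=
  ¬ ∃ r, r ≤ p ∧ r ≤ q

/-- A preorder is atomless if every element has two incompatible elements below it. -/
def AtomlessOrder (P : Type*) [Preorder P] : Prop :=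
  ∀ p : P, ∃ q r : P, q ≤ p ∧ r ≤ p ∧ Incompatible q r

/-- A preorder is `σ`-closed if every countable decreasing sequence has a lower bound. -/
def SigmaClosed (P : Type*) [Preorder P] : Prop :=
  ∀ s : ℕ → P, Antitone s → ∃ q : P, ∀ n, q ≤ s n

/-- The base tree property: there is a dense subset (one with an element below every
element of `P`) which, with the induced order, is atomless,
`σ`-closed and of size at most continuum. -/
def BTProperty (P : Type*) [Preorder P] : Prop :=
  ∃ D : Set P, IsCoinitial D ∧ AtomlessOrder D ∧ SigmaClosed D ∧ #D ≤ 𝔠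

/-- `RO(P)`, the algebra of regular open subsets of `P`. The open sets are the lower sets of `P`;
in the Heyting algebra of open sets, `Uᶜ` is the interior of the set-theoretic complement of `U`,
and `U` is regular if `Uᶜᶜ = U`. -/
abbrev RO (P : Type*) [Preorder P] : Type _ :=
  Heyting.Regular (LowerSet P)

/-- Nodes of the complete binary tree of height `ω₁`: the functions from a countable ordinal
(a proper initial segment of `ω₁`) to `{0, 1}`. -/
structure BinTree : Type where
  /-- The countable ordinal which is the domain of the node. -/
  length : (ω₁ : Ordinal.{0}).ToType
  /-- The function. -/
  val : Set.Iio length → Bool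

namespace BinTree

/-- The forcing order: `s ≤ t` if `s` extends `t` as a function. -/
instance : PartialOrder BinTree where
  le s t := ∃ h : t.length ≤ s.length, ∀ i : Set.Iio t.length,
    s.val ⟨i.1, lt_of_lt_of_le i.2 h⟩ = t.val i
  le_refl s := ⟨le_rfl, fun _ => rfl⟩
  le_trans s t u := by
    rintro ⟨h₁, h₂⟩ ⟨h₃, h₄⟩
    exact ⟨h₃.trans h₁, fun i => (h₂ ⟨i.1, lt_of_lt_of_le i.2 h₃⟩).trans (h₄ i)⟩
  le_antisymm s t := by
    obtain ⟨a, f⟩ := s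
    obtain ⟨b, g⟩ := t
    rintro ⟨h₁, h₂⟩ ⟨h₃, _⟩
    obtain rfl : a = b := le_antisymm h₃ h₁
    congr 1
    funext i
    exact h₂ i

end BinTree

/-- The collapsing algebra `Coll(ω₁, 𝔠)`: the Boolean completion of the complete binary tree of
height `ω₁`. -/
abbrev Coll : Type :=
  RO BinTree

/-- A subalgebra `B` of a Boolean algebra `C` is regular if every supremum that exists in `B` is
also the supremum in `C`. -/
def IsRegularSubalgebra {C : Type*} [BooleanAlgebra C] (B : BooleanSubalgebra C) : Prop :=
  ∀ (S : Set B) (a : B), IsLUB S a → IsLUB ((fun b : B => (b : C)) '' S) (a : C)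

/-- A partial order is (order-)complete if every subset has a supremum. -/
def IsCompleteOrder (B : Type*) [PartialOrder B] : Prop :=
  ∀ S : Set B, ∃ a : B, IsLUB S a

/-- The nonzero elements of a Boolean algebra, with the induced order. Order-theoretic forcing
properties of a Boolean algebra are those of this order. -/
abbrev Positive (B : Type*) [BooleanAlgebra B] : Type _ :=
  {b : B // b ≠ ⊥}

universe u

/-! Both halves rest on projections: monotone maps for which anything below the image of a condition
is refined by the image of a smaller condition. Pulling regular open sets back along a projection
preserves complements and suprema, so the pullbacks form a regular subalgebra.

For (1), a nonempty σ-closed order `D` of size at most `𝔠` is a projection of the tree. A binary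
sequence drives a descent: at each limit ordinal its tail codes an element of `D`, to which the
descent moves if it can; otherwise it takes a lower bound of its past, without dropping if the past
has a least value (`exists_tail_code`, `exists_walk_eq_code`).

For (2), sending a node to the least element of `B` containing it is a projection `π`
(`exists_isProjection_positive`). An image of a σ-closed order need not be σ-closed, so a dense
σ-closed set is built as in the base tree theorem. Below suitable `b` there is one cardinal `κ > ℵ₀`
at which distributivity first fails below every element. A recursion of length `κ` gives refining
maximal antichains. Each `π t` is compatible with `𝔠` members of some level (`IsLevel.exists_rich`),
which leaves room to put a member of every later level below it (`exists_isLevel`); hence the union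
is dense. Members carry witnesses in the tree, threaded through the levels, so that a sequence
climbing through the levels is interleaved with images of a decreasing sequence of nodes and
inherits a lower bound (`IsLevel.sigmaClosed_iUnion`). -/

/-! ### Countable ordinals and the binary tree -/

theorem mk_omega_one_toType : #(ω₁ : Ordinal.{0}).ToType = ℵ₁ := by
  rw [Cardinal.mk_toType, Ordinal.card_omega]

theorem countable_Iio_omega_one_toType (i : (ω₁ : Ordinal.{0}).ToType) :
    (Set.Iio i).Countable := by
  rw [← Cardinal.le_aleph0_iff_set_countable, ← Order.lt_succ_iff, Cardinal.succ_aleph0,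
    ← mk_omega_one_toType]
  refine Cardinal.mk_Iio_lt i ?_
  rw [mk_omega_one_toType, Cardinal.ord_aleph, Ordinal.type_toType]

theorem bddAbove_of_countable_omega_one_toType {C : Set (ω₁ : Ordinal.{0}).ToType}
    (hC : C.Countable) : ∃ u, ∀ c ∈ C, c < u := by
  by_contra! hu
  have h1 : (Set.univ : Set (ω₁ : Ordinal.{0}).ToType) = ⋃ c ∈ C, insert c (Set.Iio c) := by
    refine (Set.eq_univ_of_forall fun u => ?_).symm
    obtain ⟨c, hc, huc⟩ := hu u
    refine Set.mem_iUnion₂.2 ⟨c, hc, ?_⟩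
    rcases huc.eq_or_lt with h | h
    · exact Or.inl h
    · exact Or.inr h
  have h2 : (Set.univ : Set (ω₁ : Ordinal.{0}).ToType).Countable := by
    rw [h1]
    exact hC.biUnion fun c _ => (countable_Iio_omega_one_toType c).insert c
  rw [← Cardinal.le_aleph0_iff_set_countable, Cardinal.mk_univ, mk_omega_one_toType] at h2
  exact absurd Cardinal.aleph0_lt_aleph_one (not_lt.2 h2)

instance : NoMaxOrder (ω₁ : Ordinal.{0}).ToType :=
  ⟨fun i => (bddAbove_of_countable_omega_one_toType (Set.countable_singleton i)).imp
    fun _ h => h i rfl⟩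

/-- The least strict upper bound of the iterated successors of `i` is a limit, so a first limit
above `i` exists. The descent will stand still from `i` until it reaches that limit. -/
theorem exists_isSuccLimit_gt (i : (ω₁ : Ordinal.{0}).ToType) :
    ∃ l, i < l ∧ Order.IsSuccLimit l ∧ ∀ j, i < j → j < l → ¬ Order.IsSuccLimit j := by
  suffices h : {l | i < l ∧ Order.IsSuccLimit l}.Nonempty by
    refine ⟨wellFounded_lt.min _ h, (wellFounded_lt.min_mem _ h).1,
      (wellFounded_lt.min_mem _ h).2, fun j hij hj hlim => ?_⟩
    exact wellFounded_lt.not_lt_min {l | i < l ∧ Order.IsSuccLimit l} ⟨hij, hlim⟩ hj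
  have hne : {u | ∀ n : ℕ, Order.succ^[n] i < u}.Nonempty := by
    obtain ⟨u, hu⟩ := bddAbove_of_countable_omega_one_toType
      (Set.countable_range fun n : ℕ => Order.succ^[n] i)
    exact ⟨u, fun n => hu _ ⟨n, rfl⟩⟩
  set u := wellFounded_lt.min _ hne
  have hmem : ∀ n : ℕ, Order.succ^[n] i < u := wellFounded_lt.min_mem _ hne
  refine ⟨u, hmem 0, ?_⟩
  rw [Order.isSuccLimit_iff]
  refine ⟨not_isMin_of_lt (hmem 0), fun k hk => ?_⟩
  have : ¬ ∀ n : ℕ, Order.succ^[n] i < k := fun h =>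
    wellFounded_lt.not_lt_min {u | ∀ n : ℕ, Order.succ^[n] i < u} h hk.lt
  push Not at this
  obtain ⟨n, hn⟩ := this
  have h3 := hmem (n + 1)
  rw [Function.iterate_succ_apply'] at h3
  exact hk.2 (hn.trans_lt (Order.lt_succ _)) h3

theorem mk_binTree_le : #BinTree ≤ 𝔠 := by
  let e : BinTree ≃ Σ α : (ω₁ : Ordinal.{0}).ToType, (Set.Iio α → Bool) :=
    { toFun := fun t => ⟨t.length, t.val⟩
      invFun := fun t => ⟨t.1, t.2⟩
      left_inv := fun _ => rfl
      right_inv := fun _ => rfl }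
  rw [Cardinal.mk_congr e, Cardinal.mk_sigma]
  calc Cardinal.sum (fun α : (ω₁ : Ordinal.{0}).ToType => #(Set.Iio α → Bool))
      ≤ Cardinal.sum (fun _ : (ω₁ : Ordinal.{0}).ToType => 𝔠) := by
        refine Cardinal.sum_le_sum _ _ fun α => ?_
        rw [← Cardinal.power_def, Cardinal.mk_bool, ← Cardinal.two_power_aleph0]
        exact Cardinal.power_le_power_left two_ne_zero
          (Cardinal.le_aleph0_iff_set_countable.2 (countable_Iio_omega_one_toType α))
    _ = ℵ₁ * 𝔠 := by rw [Cardinal.sum_const', mk_omega_one_toType]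
    _ ≤ 𝔠 * 𝔠 := by gcongr; exact Cardinal.aleph_one_le_continuum
    _ = 𝔠 := Cardinal.continuum_mul_self

namespace BinTree

/-- The extension of a node by `false` to a function on all countable ordinals. -/
noncomputable def extend (t : BinTree) (i : (ω₁ : Ordinal.{0}).ToType) : Bool :=
  open Classical in if h : i < t.length then t.val ⟨i, h⟩ else false

theorem extend_of_lt (t : BinTree) {i : (ω₁ : Ordinal.{0}).ToType} (h : i < t.length) :
    t.extend i = t.val ⟨i, h⟩ := dif_pos h

theorem le_iff {s t : BinTree} :
    s ≤ t ↔ t.length ≤ s.length ∧ ∀ i < t.length, s.extend i = t.extend i := by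
  constructor
  · rintro ⟨h, hv⟩
    refine ⟨h, fun i hi => ?_⟩
    rw [extend_of_lt _ hi, extend_of_lt _ (hi.trans_le h)]
    exact hv ⟨i, hi⟩
  · rintro ⟨h, hv⟩
    refine ⟨h, fun i => ?_⟩
    have := hv i i.2
    rwa [extend_of_lt _ i.2, extend_of_lt _ (lt_of_lt_of_le i.2 h)] at this

/-- The restriction of a function on all countable ordinals to those below `α`. -/
def restrict (x : (ω₁ : Ordinal.{0}).ToType → Bool) (α : (ω₁ : Ordinal.{0}).ToType) : BinTree :=
  ⟨α, fun i => x i⟩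

theorem extend_restrict (x : (ω₁ : Ordinal.{0}).ToType → Bool)
    {α i : (ω₁ : Ordinal.{0}).ToType} (h : i < α) : (restrict x α).extend i = x i :=
  extend_of_lt _ h

theorem sigmaClosed : SigmaClosed BinTree := by
  classical
  intro s hs
  obtain ⟨u, hu⟩ := bddAbove_of_countable_omega_one_toType
    (Set.countable_range fun n => (s n).length)
  have hcoh : ∀ m n i, i < (s m).length → i < (s n).length →
      (s m).extend i = (s n).extend i := by
    intro m n i hm hn
    rcases le_total m n with h | h
    · exact ((le_iff.1 (hs h)).2 i hm).symm
    · exact (le_iff.1 (hs h)).2 i hn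
  refine ⟨restrict (fun i => if h : ∃ n, i < (s n).length then (s h.choose).extend i else false) u,
    fun n => le_iff.2 ⟨(hu _ ⟨n, rfl⟩).le, fun i hi => ?_⟩⟩
  have h : ∃ n, i < (s n).length := ⟨n, hi⟩
  rw [extend_restrict _ (hi.trans (hu _ ⟨n, rfl⟩)), dif_pos h]
  exact hcoh _ _ _ h.choose_spec hi

end BinTree

/-! ### Regular open sets and their pullback along projections -/

theorem LowerSet.mem_compl_iff_forall_le {P : Type*} [Preorder P] {U : LowerSet P} {x : P} :
    x ∈ Uᶜ ↔ ∀ y ≤ x, y ∉ U := by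
  rw [← LowerSet.Iic_le, le_compl_iff_disjoint_right, disjoint_iff_inf_le]
  constructor
  · intro h y hy hyU
    exact (h (show y ∈ LowerSet.Iic x ⊓ U from ⟨hy, hyU⟩)).elim
  · rintro h y ⟨hy, hyU⟩
    exact (h y hy hyU).elim

namespace RO

theorem mem_iff_forall_le_exists_le {P : Type*} [Preorder P] (U : RO P) {x : P} :
    x ∈ (U : LowerSet P) ↔ ∀ y ≤ x, ∃ z ≤ y, z ∈ (U : LowerSet P) := by
  conv_lhs => rw [← U.prop.eq]
  simp only [LowerSet.mem_compl_iff_forall_le]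
  push Not
  rfl

/-- The regular open set generated by `p`: all elements every extension of which is compatible
with `p`. -/
def ofElement {P : Type*} [Preorder P] (p : P) : RO P :=
  ⟨(LowerSet.Iic p)ᶜᶜ, Heyting.isRegular_compl _⟩

theorem ofElement_le_iff {P : Type*} [Preorder P] {p : P} {U : RO P} :
    ofElement p ≤ U ↔ p ∈ (U : LowerSet P) := by
  rw [← Heyting.Regular.coe_le_coe, ← LowerSet.Iic_le]
  constructor
  · exact fun h => le_compl_compl.trans h
  · intro h
    rw [← U.prop.eq]
    exact compl_le_compl (compl_le_compl h)

theorem mem_compl_iff {P : Type*} [Preorder P] {p : P} {U : RO P} :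
    p ∈ ((Uᶜ : RO P) : LowerSet P) ↔ ∀ q ≤ p, q ∉ (U : LowerSet P) := by
  rw [Heyting.Regular.coe_compl, LowerSet.mem_compl_iff_forall_le]

/-- A map from `X` to the lower sets of `P` along which regular open sets can be pulled back. -/
structure Projection (X P : Type*) [Preorder X] [Preorder P] where
  /-- The underlying map. -/
  toFun : X → LowerSet P
  monotone : Monotone toFun
  lift : ∀ x, ∀ p ∈ toFun x, ∃ x' ≤ x, toFun x' ≤ LowerSet.Iic p
  nonempty : ∀ x, ∃ p, p ∈ toFun x
  dense : ∀ p, ∃ x, toFun x ≤ LowerSet.Iic p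

namespace Projection

variable {X P : Type*} [Preorder X] [Preorder P] (f : Projection X P)

/-- The pullback of a regular open set along a projection. -/
def comap (U : RO P) : RO X :=
  ⟨⟨{x | f.toFun x ≤ U}, fun _ _ h hx => (f.monotone h).trans hx⟩, by
    refine le_antisymm (fun x hx p hp => ?_) le_compl_compl
    rw [SetLike.mem_coe] at hx
    simp only [LowerSet.mem_compl_iff_forall_le] at hx
    push Not at hx
    refine (mem_iff_forall_le_exists_le U).2 fun q hq => ?_
    obtain ⟨x', hx', hle⟩ := f.lift x q ((f.toFun x).lower hq hp)
    obtain ⟨z, hz, hzU⟩ := hx x' hx'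
    obtain ⟨r, hr⟩ := f.nonempty z
    exact ⟨r, hle (f.monotone hz hr), hzU hr⟩⟩

theorem mem_comap {U : RO P} {x : X} :
    x ∈ (f.comap U : LowerSet X) ↔ f.toFun x ≤ (U : LowerSet P) := Iff.rfl

theorem comap_le_comap {U V : RO P} : f.comap U ≤ f.comap V ↔ U ≤ V := by
  constructor
  · intro h p hp
    refine (mem_iff_forall_le_exists_le V).2 fun q hq => ?_
    obtain ⟨x, hx⟩ := f.dense q
    have hxU : x ∈ (f.comap U : LowerSet X) := fun r hr =>
      (U : LowerSet P).lower ((hx hr).trans hq : r ≤ p) hp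
    obtain ⟨r, hr⟩ := f.nonempty x
    exact ⟨r, hx hr, h hxU hr⟩
  · exact fun h x hx => le_trans (α := LowerSet P) hx h

theorem comap_compl (U : RO P) : f.comap Uᶜ = (f.comap U)ᶜ := by
  refine Heyting.Regular.coe_injective (SetLike.ext fun x => ?_)
  rw [mem_compl_iff, mem_comap]
  constructor
  · intro h y hy hyU
    obtain ⟨p, hp⟩ := f.nonempty y
    exact mem_compl_iff.1 (h (f.monotone hy hp)) p le_rfl (hyU hp)
  · intro h p hp
    refine mem_compl_iff.2 fun q hq hqU => ?_
    obtain ⟨y, hy, hyq⟩ := f.lift x q ((f.toFun x).lower hq hp)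
    exact h y hy (hyq.trans (LowerSet.Iic_le.2 hqU))

theorem comap_inf (U V : RO P) : f.comap (U ⊓ V) = f.comap U ⊓ f.comap V := by
  refine Heyting.Regular.coe_injective (SetLike.ext fun x => ?_)
  exact le_inf_iff (α := LowerSet P)

theorem comap_sup (U V : RO P) : f.comap (U ⊔ V) = f.comap U ⊔ f.comap V := by
  rw [← compl_inj_iff, ← comap_compl, compl_sup, compl_sup]
  exact (f.comap_inf _ _).trans (congrArg₂ (· ⊓ ·) (f.comap_compl U) (f.comap_compl V))

theorem comap_bot : f.comap ⊥ = ⊥ := by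
  rw [← inf_compl_self ⊥]
  exact ((f.comap_inf _ _).trans (congrArg _ (f.comap_compl ⊥))).trans
    (inf_compl_self _)

/-- The range of the pullback along a projection, as a Boolean subalgebra. -/
def subalgebra : BooleanSubalgebra (RO X) where
  carrier := Set.range f.comap
  supClosed' := by
    rintro _ ⟨U, rfl⟩ _ ⟨V, rfl⟩
    exact ⟨U ⊔ V, f.comap_sup U V⟩
  infClosed' := by
    rintro _ ⟨U, rfl⟩ _ ⟨V, rfl⟩
    exact ⟨U ⊓ V, f.comap_inf U V⟩
  compl_mem' := by
    rintro _ ⟨U, rfl⟩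
    exact ⟨Uᶜ, f.comap_compl U⟩
  bot_mem' := ⟨⊥, f.comap_bot⟩

/-- The pullback along a projection is an isomorphism onto its range. -/
noncomputable def orderIso : RO P ≃o f.subalgebra where
  toEquiv := Equiv.ofBijective (fun U => ⟨f.comap U, U, rfl⟩) (by
    constructor
    · intro U V h
      have h' : f.comap U = f.comap V := congrArg Subtype.val h
      exact le_antisymm (f.comap_le_comap.1 h'.le) (f.comap_le_comap.1 h'.ge)
    · rintro ⟨_, U, rfl⟩
      exact ⟨U, rfl⟩)
  map_rel_iff' := f.comap_le_comap

/-- Below any `p` in the supremum `U` some `q` lies in a member of `S`: otherwise the complement of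
`ofElement p` would bound `S`, and hence `U`, although `p ∈ U`. The lifting property carries `q`
back to `X`. -/
theorem isLUB_comap {S : Set (RO P)} {U : RO P} (h : IsLUB S U) :
    IsLUB (f.comap '' S) (f.comap U) := by
  constructor
  · rintro _ ⟨V, hV, rfl⟩
    exact f.comap_le_comap.2 (h.1 hV)
  · intro W hW x hx
    refine (mem_iff_forall_le_exists_le W).2 fun y hy => ?_
    have hyU : f.toFun y ≤ (U : LowerSet P) := (f.monotone hy).trans hx
    obtain ⟨p, hp⟩ := f.nonempty y
    have : ∃ q ≤ p, ∃ V ∈ S, q ∈ (V : LowerSet P) := by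
      by_contra! hcon
      have hub : (ofElement p)ᶜ ∈ upperBounds S := fun V hV => by
        rw [← compl_le_compl_iff_le, compl_compl, ofElement_le_iff, mem_compl_iff]
        exact fun q hq => hcon q hq V hV
      exact mem_compl_iff.1 (h.2 hub (hyU hp)) p le_rfl (ofElement_le_iff.1 le_rfl)
    obtain ⟨q, hq, V, hV, hqV⟩ := this
    obtain ⟨z, hz, hzq⟩ := f.lift y q ((f.toFun y).lower hq hp)
    exact ⟨z, hz, hW ⟨V, hV, rfl⟩ (hzq.trans (LowerSet.Iic_le.2 hqV))⟩

theorem isRegularSubalgebra : IsRegularSubalgebra f.subalgebra := by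
  intro S a ha
  have h1 : IsLUB (f.orderIso.symm '' S) (f.orderIso.symm a) :=
    f.orderIso.symm.isLUB_image'.2 ha
  have h2 := f.isLUB_comap h1
  have h3 : ∀ b : f.subalgebra, f.comap (f.orderIso.symm b) = b := fun b =>
    congrArg Subtype.val (f.orderIso.apply_symm_apply b)
  rwa [Set.image_image, h3, Set.image_congr fun b _ => h3 b] at h2

end Projection

end RO

/-! ### Coding elements in tails below a limit ordinal -/

theorem exists_strictMono_cofinal_of_isSuccLimit {i : (ω₁ : Ordinal.{0}).ToType}
    (hi : Order.IsSuccLimit i) :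
    ∃ s : ℕ → (ω₁ : Ordinal.{0}).ToType, StrictMono s ∧ (∀ n, s n < i) ∧
      ∀ j < i, ∃ N, ∀ n ≥ N, j ≤ s n := by
  obtain ⟨k, hk⟩ := not_isMin_iff.1 hi.not_isMin
  have : Nonempty (Set.Iio i) := ⟨⟨k, hk⟩⟩
  have : Countable (Set.Iio i) := countable_Iio_omega_one_toType i
  have : NoMaxOrder (Set.Iio i) := ⟨fun a => by
    obtain ⟨b, hb, hbi⟩ := hi.lt_iff_exists_lt.1 a.2
    exact ⟨⟨b, hb⟩, hbi⟩⟩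
  obtain ⟨u, -, hu⟩ := Filter.exists_seq_monotone_tendsto_atTop_atTop (Set.Iio i)
  obtain ⟨φ, hφ, hs⟩ := Filter.strictMono_subseq_of_tendsto_atTop hu
  refine ⟨fun n => u (φ n), fun m n h => hs h, fun n => (u (φ n)).2, fun j hj => ?_⟩
  exact Filter.eventually_atTop.1
    ((hu.comp hφ.tendsto_atTop).eventually_ge_atTop ⟨j, hj⟩)

/-- Elements of a set of size continuum can be read off the restriction of a binary sequence to a
limit ordinal, in such a way that proper initial segments of it do not matter. -/
theorem exists_tail_code {D : Type*} [Nonempty D] (hD : #D ≤ 𝔠) :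
    ∃ code : (ω₁ : Ordinal.{0}).ToType → ((ω₁ : Ordinal.{0}).ToType → Bool) → D,
      (∀ i x y, (∀ k < i, x k = y k) → code i x = code i y) ∧
      ∀ i, Order.IsSuccLimit i → ∀ j < i, ∀ (x : (ω₁ : Ordinal.{0}).ToType → Bool) (d : D),
        ∃ y, (∀ k < j, y k = x k) ∧ code i y = d := by
  classical
  obtain ⟨g, hg⟩ : ∃ g : (ℕ → Bool) → D, Function.Surjective g := by
    have h : Cardinal.lift.{0} #D ≤ Cardinal.lift #(ℕ → Bool) := by
      simpa using hD
    obtain ⟨e⟩ := Cardinal.lift_mk_le'.1 h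
    exact ⟨Function.invFun e, Function.invFun_surjective e.injective⟩
  have hs : ∀ i : (ω₁ : Ordinal.{0}).ToType, ∃ s : ℕ → (ω₁ : Ordinal.{0}).ToType,
      Order.IsSuccLimit i → StrictMono s ∧ (∀ n, s n < i) ∧
        ∀ j < i, ∃ N, ∀ n ≥ N, j ≤ s n := by
    intro i
    by_cases hi : Order.IsSuccLimit i
    · obtain ⟨s, h⟩ := exists_strictMono_cofinal_of_isSuccLimit hi
      exact ⟨s, fun _ => h⟩
    · exact ⟨fun _ => i, fun h => (hi h).elim⟩
  choose s hs using hs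
  -- Pairing splits a cofinal ω-sequence in `i` into infinitely many infinite pieces. Bit `n`
  -- records whether `x` is true infinitely often on piece `n`, which no change of `x` below some `j
  -- < i` can affect.
  refine ⟨fun i x => g fun n => decide (Order.IsSuccLimit i ∧
    ∃ᶠ m in Filter.atTop, x (s i (Nat.pair n m)) = true), ?_, ?_⟩
  · intro i x y hxy
    refine congrArg g (funext fun n => ?_)
    by_cases hi : Order.IsSuccLimit i
    · have : ∀ m, x (s i (Nat.pair n m)) = y (s i (Nat.pair n m)) := fun m =>
        hxy _ ((hs i hi).2.1 _)
      simp only [this]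
    · simp only [hi, false_and]
  · intro i hi j hj x d
    obtain ⟨b, rfl⟩ := hg d
    refine ⟨fun k => if k < j then x k else
      decide (∃ n m, k = s i (Nat.pair n m) ∧ b n = true), fun k hk => if_pos hk, ?_⟩
    refine congrArg g (funext fun n => ?_)
    obtain ⟨N, hN⟩ := (hs i hi).2.2 j hj
    have h : ∀ m ≥ N, ((if s i (Nat.pair n m) < j then x (s i (Nat.pair n m)) else
        decide (∃ n' m', s i (Nat.pair n m) = s i (Nat.pair n' m') ∧ b n' = true)) = true ↔
          b n = true) := by
      intro m hm
      rw [if_neg (not_lt.2 (hN _ (hm.trans (Nat.right_le_pair n m)))), decide_eq_true_iff]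
      constructor
      · rintro ⟨n', m', h, hb⟩
        have h := (hs i hi).1.injective h
        rw [Nat.pair_eq_pair] at h
        rwa [h.1]
      · exact fun hb => ⟨n, m, rfl, hb⟩
    have h' : (∃ᶠ m in Filter.atTop, (if s i (Nat.pair n m) < j then x (s i (Nat.pair n m)) else
        decide (∃ n' m', s i (Nat.pair n m) = s i (Nat.pair n' m') ∧ b n' = true)) = true) ↔
          b n = true := by
      rw [Filter.frequently_congr (Filter.eventually_atTop.2 ⟨N, h⟩)]
      exact Filter.frequently_const
    simp only [hi, true_and, h', Bool.decide_eq_true]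

/-! ### The coded descent and part (1) -/

theorem WithTop.eq_top_of_top_le {D : Type*} [Preorder D] {a : WithTop D} (h : ⊤ ≤ a) :
    a = ⊤ := by
  cases a with
  | top => rfl
  | coe d => exact (WithTop.not_top_le_coe d h).elim

theorem SigmaClosed.withTop {D : Type*} [Preorder D] (hD : SigmaClosed D) :
    SigmaClosed (WithTop D) := by
  intro s hs
  by_cases h : ∃ n, s n ≠ ⊤
  · obtain ⟨n, hn⟩ := h
    have hne : ∀ m, s (n + m) ≠ ⊤ := fun m hm => hn (by
      have := hs (Nat.le_add_right n m)
      rw [hm] at this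
      exact WithTop.eq_top_of_top_le this)
    choose d hd using fun m => WithTop.ne_top_iff_exists.1 (hne m)
    obtain ⟨q, hq⟩ := hD d fun a b hab => by
      rw [← WithTop.coe_le_coe, hd, hd]
      exact hs (by omega)
    refine ⟨q, fun m => ?_⟩
    have h1 : (q : WithTop D) ≤ s (n + m) := by
      rw [← hd]
      exact WithTop.coe_le_coe.2 (hq m)
    exact h1.trans (hs (Nat.le_add_left m n))
  · push Not at h
    exact ⟨⊤, fun n => (h n).ge⟩

section Walk

variable {Q : Type*} [Preorder Q] [OrderTop Q]

/-- A lower bound of `S` which is a least element of `S` if there is one (when it exists). -/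
noncomputable def tightBound (S : Set Q) : Q :=
  open Classical in
  if h : ∃ e, e ∈ lowerBounds S ∧ ∀ m ∈ S, m ∈ lowerBounds S → m ≤ e then h.choose else ⊤

theorem tightBound_spec {S : Set Q}
    (h : ∃ e, e ∈ lowerBounds S ∧ ∀ m ∈ S, m ∈ lowerBounds S → m ≤ e) :
    tightBound S ∈ lowerBounds S ∧ ∀ m ∈ S, m ∈ lowerBounds S → m ≤ tightBound S := by
  rw [tightBound, dif_pos h]
  exact h.choose_spec

/-- The descent in `Q` described by the binary sequence `x`: at limit steps move to the element
coded by `x`, if possible. -/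
noncomputable def walk
    (code : (ω₁ : Ordinal.{0}).ToType → ((ω₁ : Ordinal.{0}).ToType → Bool) → Q)
    (x : (ω₁ : Ordinal.{0}).ToType → Bool) : (ω₁ : Ordinal.{0}).ToType → Q :=
  open Classical in
  wellFounded_lt.fix fun i rec =>
    if Order.IsSuccLimit i ∧ code i x ≤ tightBound (insert ⊤ {q | ∃ j, ∃ h : j < i, q = rec j h})
    then code i x else tightBound (insert ⊤ {q | ∃ j, ∃ h : j < i, q = rec j h})

variable {code : (ω₁ : Ordinal.{0}).ToType → ((ω₁ : Ordinal.{0}).ToType → Bool) → Q}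
  {x y : (ω₁ : Ordinal.{0}).ToType → Bool} {i j : (ω₁ : Ordinal.{0}).ToType}

open Classical in
theorem walk_eq : walk code x i =
    if Order.IsSuccLimit i ∧ code i x ≤ tightBound (insert ⊤ (walk code x '' Set.Iio i))
    then code i x else tightBound (insert ⊤ (walk code x '' Set.Iio i)) := by
  have h : {q | ∃ j, ∃ _ : j < i, q = walk code x j} = walk code x '' Set.Iio i := by
    ext q
    simp only [Set.mem_ofPred_eq, Set.mem_image, Set.mem_Iio, exists_prop, eq_comm]
  conv_lhs => rw [walk, WellFounded.fix_eq]
  rw [← h]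
  rfl

theorem walk_le_tightBound :
    walk code x i ≤ tightBound (insert ⊤ (walk code x '' Set.Iio i)) := by
  rw [walk_eq]
  split_ifs with h
  · exact h.2
  · exact le_rfl

theorem walk_congr (hcode : ∀ i x y, (∀ k < i, x k = y k) → code i x = code i y)
    (h : ∀ k < i, x k = y k) : walk code x i = walk code y i := by
  induction i using WellFoundedLT.induction with
  | ind i ih =>
    have : walk code x '' Set.Iio i = walk code y '' Set.Iio i :=
      Set.image_congr fun j hj => ih j hj fun k hk => h k (hk.trans hj)
    rw [walk_eq, walk_eq, this, hcode i x y h]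

/-- If the set has a least element, that element serves. If not, the second clause is vacuous, and
σ-closedness along a countable cofinal sequence gives a lower bound. -/
theorem exists_tightBound_of_antitoneOn (hQ : SigmaClosed Q)
    {d : (ω₁ : Ordinal.{0}).ToType → Q} (hd : AntitoneOn d (Set.Iio i)) :
    ∃ e, e ∈ lowerBounds (insert ⊤ (d '' Set.Iio i)) ∧
      ∀ m ∈ insert ⊤ (d '' Set.Iio i), m ∈ lowerBounds (insert ⊤ (d '' Set.Iio i)) → m ≤ e := by
  by_cases hmin : ∃ m ∈ insert ⊤ (d '' Set.Iio i), m ∈ lowerBounds (insert ⊤ (d '' Set.Iio i))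
  · obtain ⟨m, hm, hlb⟩ := hmin
    exact ⟨m, hlb, fun m' _ hm' => hm' hm⟩
  · suffices h : ∃ e, e ∈ lowerBounds (insert ⊤ (d '' Set.Iio i)) from
      h.imp fun e he => ⟨he, fun m hm hlb => (hmin ⟨m, hm, hlb⟩).elim⟩
    rcases isEmpty_or_nonempty (Set.Iio i) with he | hne
    · refine ⟨⊤, ?_⟩
      rintro _ (rfl | ⟨j, hj, -⟩)
      · exact le_rfl
      · exact (he.false ⟨j, hj⟩).elim
    · have : Countable (Set.Iio i) := countable_Iio_omega_one_toType i
      obtain ⟨u, hu, hlim⟩ := Filter.exists_seq_monotone_tendsto_atTop_atTop (Set.Iio i)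
      obtain ⟨q, hq⟩ := hQ (fun n => d (u n)) fun m n h => hd (u m).2 (u n).2 (hu h)
      refine ⟨q, ?_⟩
      rintro _ (rfl | ⟨j, hj, rfl⟩)
      · exact le_top
      · obtain ⟨n, hn⟩ := (hlim.eventually_ge_atTop ⟨j, hj⟩).exists
        exact (hq n).trans (hd hj (u n).2 hn)

theorem walk_antitone (hQ : SigmaClosed Q) : Antitone (walk code x) := by
  have h : ∀ i, ∀ j < i, walk code x i ≤ walk code x j := by
    intro i
    induction i using WellFoundedLT.induction with
    | ind i ih =>
      intro j hj
      have hd : AntitoneOn (walk code x) (Set.Iio i) := fun a _ b hb hab => by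
        rcases hab.eq_or_lt with rfl | hab
        · exact le_rfl
        · exact ih b hb a hab
      exact walk_le_tightBound.trans
        ((tightBound_spec (exists_tightBound_of_antitoneOn hQ hd)).1
          (Or.inr ⟨j, hj, rfl⟩))
  intro i j hij
  rcases hij.eq_or_lt with rfl | hij
  · exact le_rfl
  · exact h j i hij

theorem le_tightBound_walk (hQ : SigmaClosed Q) (hj : j < i)
    (h : ∀ k < i, walk code x j ≤ walk code x k) :
    walk code x j ≤ tightBound (insert ⊤ (walk code x '' Set.Iio i)) := by
  refine (tightBound_spec
    (exists_tightBound_of_antitoneOn hQ ((walk_antitone hQ).antitoneOn _))).2 _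
      (Or.inr ⟨j, hj, rfl⟩) ?_
  rintro _ (rfl | ⟨k, hk, rfl⟩)
  · exact le_top
  · exact h k hk

/-- Away from limits the walk takes the tight bound of its past, which stays above the least value
reached so far. -/
theorem walk_le_of_no_limit (hQ : SigmaClosed Q) (hij : i ≤ j)
    (hlim : ∀ k, i < k → k ≤ j → ¬ Order.IsSuccLimit k) : walk code x i ≤ walk code x j := by
  induction j using WellFoundedLT.induction with
  | ind j ih =>
    rcases hij.eq_or_lt with rfl | hij
    · exact le_rfl
    · rw [walk_eq (i := j), if_neg fun h => hlim j hij le_rfl h.1]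
      refine le_tightBound_walk hQ hij fun k hk => ?_
      rcases le_total i k with hik | hki
      · exact ih k hk hik fun l h1 h2 => hlim l h1 (h2.trans hk.le)
      · exact walk_antitone hQ hki

/-- At the first limit `l` above `i` the tail of the sequence can be altered to code `q`. The walk
has not dropped since stage `i`, so the move to `q` is still permitted. -/
theorem exists_walk_eq_code (hQ : SigmaClosed Q)
    (hcode : ∀ i x y, (∀ k < i, x k = y k) → code i x = code i y) {q : Q}
    (hsurj : ∀ i, Order.IsSuccLimit i → ∀ j < i, ∀ x : (ω₁ : Ordinal.{0}).ToType → Bool,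
        ∃ y, (∀ k < j, y k = x k) ∧ code i y = q)
    (hq : q ≤ walk code x i) :
    ∃ l, i < l ∧ ∃ y, (∀ k < i, y k = x k) ∧ walk code y l = q := by
  obtain ⟨l, hil, hl, hmin⟩ := exists_isSuccLimit_gt i
  obtain ⟨y, hyx, hy⟩ := hsurj l hl i hil x
  refine ⟨l, hil, y, hyx, ?_⟩
  rw [walk_eq, if_pos, hy]
  refine ⟨hl, ?_⟩
  rw [hy]
  refine hq.trans ((walk_congr hcode fun k hk => (hyx k hk).symm).le.trans
    (le_tightBound_walk hQ hil fun k hk => ?_))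
  rcases le_total i k with hik | hki
  · exact walk_le_of_no_limit hQ hik fun m h1 h2 => hmin m h1 (h2.trans_lt hk)
  · exact walk_antitone hQ hki

end Walk

/-- Every nonempty `σ`-closed preorder of size at most continuum is a projection of the complete
binary tree of height `ω₁`. -/
theorem exists_binTree_projection {D : Type*} [Preorder D] [Nonempty D] (hD : SigmaClosed D)
    (hcard : #D ≤ 𝔠) :
    ∃ π : BinTree → WithTop D, Monotone π ∧ (∀ t, ∀ d : D, d ≤ π t → ∃ s ≤ t, π s = d) ∧
      ∃ t, π t = ⊤ := by
  obtain ⟨code, hcode, hsurj⟩ := exists_tail_code hcard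
  set c : (ω₁ : Ordinal.{0}).ToType → ((ω₁ : Ordinal.{0}).ToType → Bool) → WithTop D :=
    fun i x => code i x with hc
  have hc' : ∀ i x y, (∀ k < i, x k = y k) → c i x = c i y := fun i x y h =>
    congrArg WithTop.some (hcode i x y h)
  refine ⟨fun t => walk c t.extend t.length, ?_, ?_, ?_⟩
  · intro s t hst
    obtain ⟨h1, h2⟩ := BinTree.le_iff.1 hst
    exact (walk_antitone hD.withTop h1).trans (walk_congr hc' h2).le
  · intro t d hd
    obtain ⟨l, hl, y, hy, hw⟩ := exists_walk_eq_code hD.withTop hc'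
      (fun i hi j hj x => (hsurj i hi j hj x d).imp fun y h => ⟨h.1, congrArg WithTop.some h.2⟩) hd
    refine ⟨BinTree.restrict y l, BinTree.le_iff.2 ⟨hl.le, fun k hk => ?_⟩, ?_⟩
    · rw [BinTree.extend_restrict _ (hk.trans hl), hy k hk]
    · rw [← hw]
      exact walk_congr hc' fun k hk => BinTree.extend_restrict _ hk
  · obtain ⟨i₀⟩ : Nonempty (ω₁ : Ordinal.{0}).ToType := by
      rw [← Cardinal.mk_ne_zero_iff, mk_omega_one_toType]
      exact (Cardinal.aleph_pos 1).ne'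
    obtain ⟨i, hi⟩ : ∃ i : (ω₁ : Ordinal.{0}).ToType, IsMin i :=
      ⟨wellFounded_lt.min Set.univ ⟨i₀, trivial⟩, isMin_iff_forall_not_lt.2 fun j hj =>
        wellFounded_lt.not_lt_min Set.univ (Set.mem_univ j) hj⟩
    -- The root of the tree, where the walk has no past and so starts at `⊤`.
    refine ⟨BinTree.restrict (fun _ => false) i, ?_⟩
    change walk c _ i = ⊤
    have hS : insert ⊤ (walk c (BinTree.restrict (fun _ => false) i).extend '' Set.Iio i)
        = {⊤} := by
      rw [hi.Iio_eq, Set.image_empty, insert_empty_eq]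
    rw [walk_eq, if_neg fun h => h.1.not_isMin hi, hS]
    have htop : (⊤ : WithTop D) ∈ lowerBounds {⊤} := fun _ h => (Set.mem_singleton_iff.1 h).ge
    exact WithTop.eq_top_of_top_le ((tightBound_spec ⟨⊤, htop, fun m _ _ => le_top⟩).2 ⊤
      (Set.mem_singleton _) htop)

theorem exists_regular_embedding_of_btProperty (P : Type*) [Preorder P] [Nonempty P]
    (hP : BTProperty P) :
    ∃ B : BooleanSubalgebra Coll, IsRegularSubalgebra B ∧ Nonempty (RO P ≃o B) := by
  obtain ⟨D, hdense, -, hclosed, hcard⟩ := hP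
  have hne : Nonempty D := by
    obtain ⟨d, hd, -⟩ := hdense (Classical.arbitrary P)
    exact ⟨⟨d, hd⟩⟩
  obtain ⟨π, hmono, hlift, t₀, ht₀⟩ := exists_binTree_projection hclosed hcard
  -- The lower set attached to `t` is the cone below `π t` when `π t` lies in `D`, and all of `P`
  -- when `π t = ⊤`; `P` itself need not have a top.
  let f : RO.Projection BinTree P :=
    { toFun := fun t => ⟨{p | ∀ d : D, π t ≤ d → p ≤ d}, fun p q hqp hp d hd =>
        hqp.trans (hp d hd)⟩
      monotone := fun s t hst p hp d hd => hp d ((hmono hst).trans hd)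
      lift := fun t p hp => by
        obtain ⟨d, hd, hdp⟩ := hdense p
        have : ((⟨d, hd⟩ : D) : WithTop D) ≤ π t := by
          rcases eq_or_ne (π t) ⊤ with h | h
          · exact h ▸ le_top
          · obtain ⟨e, he⟩ := WithTop.ne_top_iff_exists.1 h
            rw [← he]
            exact WithTop.coe_le_coe.2 (hdp.trans (hp e he.ge))
        obtain ⟨s, hs, hsd⟩ := hlift t _ this
        exact ⟨s, hs, fun q hq => (hq ⟨d, hd⟩ hsd.le).trans hdp⟩
      nonempty := fun t => by
        rcases eq_or_ne (π t) ⊤ with h | h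
        · refine ⟨Classical.arbitrary P, fun d hd => ?_⟩
          rw [h] at hd
          exact (WithTop.not_top_le_coe d hd).elim
        · obtain ⟨e, he⟩ := WithTop.ne_top_iff_exists.1 h
          refine ⟨e, fun d hd => ?_⟩
          rw [← he] at hd
          exact Subtype.coe_le_coe.2 (WithTop.coe_le_coe.1 hd)
      dense := fun p => by
        obtain ⟨d, hd, hdp⟩ := hdense p
        obtain ⟨s, -, hsd⟩ := hlift t₀ ⟨d, hd⟩ (ht₀ ▸ le_top)
        exact ⟨s, fun q hq => (hq ⟨d, hd⟩ hsd.le).trans hdp⟩ }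
  exact ⟨f.subalgebra, f.isRegularSubalgebra, ⟨f.orderIso⟩⟩

/-! ### Projections onto the nonzero elements of a regular subalgebra -/

/-- A monotone map with coinitial range such that everything below `π t` has an element below it
of the form `π s` with `s ≤ t`. -/
structure IsProjection {T Q : Type*} [Preorder T] [Preorder Q] (π : T → Q) : Prop where
  monotone : Monotone π
  lift : ∀ t, ∀ q ≤ π t, ∃ s ≤ t, π s ≤ q
  dense : ∀ q, ∃ t, π t ≤ q

/-- An open dense subset of a preorder: a lower set with an element below every element. -/
structure IsOpenDense {Q : Type*} [Preorder Q] (U : Set Q) : Prop where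
  isLowerSet : IsLowerSet U
  isCoinitial : IsCoinitial U

/-- A preorder is separative if elements not below `q` have an element below them that is
incompatible with `q`. -/
def SeparativeOrder (Q : Type*) [Preorder Q] : Prop :=
  ∀ p q : Q, ¬ p ≤ q → ∃ r ≤ p, Incompatible r q

theorem separativeOrder_positive (B : Type*) [BooleanAlgebra B] :
    SeparativeOrder (Positive B) := by
  intro p q hpq
  refine ⟨⟨p.1 ⊓ q.1ᶜ, fun h => hpq ?_⟩, (inf_le_left : p.1 ⊓ q.1ᶜ ≤ p.1), ?_⟩
  · rw [← disjoint_iff, disjoint_compl_right_iff] at h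
    exact h
  · rintro ⟨r, h1, h2⟩
    have h1' : r.1 ≤ p.1 ⊓ q.1ᶜ := h1
    have h2' : r.1 ≤ q.1 := h2
    exact r.2 (le_bot_iff.1 ((le_inf h2' (h1'.trans inf_le_right)).trans (inf_compl_self q.1).le))

theorem atomlessOrder_positive {B : Type*} [BooleanAlgebra B] (h : ∀ a : B, ¬ IsAtom a) :
    AtomlessOrder (Positive B) := by
  intro p
  obtain ⟨q, hqp, hq⟩ : ∃ q < p.1, q ≠ ⊥ := by
    by_contra! hcon
    exact h p.1 ⟨p.2, hcon⟩
  have hnot : ¬ p ≤ ⟨q, hq⟩ := fun hle => hqp.not_ge hle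
  obtain ⟨r, hr, hinc⟩ := separativeOrder_positive B p ⟨q, hq⟩ hnot
  exact ⟨r, ⟨q, hq⟩, hr, hqp.le, hinc⟩

/-- If `B` is a complete regular subalgebra of `RO(X)`, every element of `X` lies in a least
element of `B`. -/
theorem exists_least_mem_subalgebra {X : Type*} [Preorder X] {B : BooleanSubalgebra (RO X)}
    (hreg : IsRegularSubalgebra B) (hcompl : IsCompleteOrder B) (x : X) :
    ∃ b : B, x ∈ ((b : RO X) : LowerSet X) ∧
      ∀ c : B, x ∈ ((c : RO X) : LowerSet X) → b ≤ c := by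
  -- `u` is the supremum of the elements of `B` whose complement contains `x`. By regularity it is
  -- also their supremum in `RO X`, so `x` lies in `uᶜ`.
  obtain ⟨u, hu⟩ := hcompl {b | RO.ofElement x ≤ (b : RO X)ᶜ}
  have hu' := hreg _ _ hu
  refine ⟨uᶜ, ?_, fun c hc => ?_⟩
  · rw [← RO.ofElement_le_iff, BooleanSubalgebra.val_compl, le_compl_comm]
    refine hu'.2 ?_
    rintro _ ⟨b, hb, rfl⟩
    exact le_compl_comm.1 hb
  · rw [compl_le_iff_compl_le]
    refine hu.1 ?_
    rw [Set.mem_ofPred_eq, BooleanSubalgebra.val_compl, compl_compl]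
    exact RO.ofElement_le_iff.2 hc

theorem RO.ne_bot_iff {X : Type*} [Preorder X] {U : RO X} :
    U ≠ ⊥ ↔ ∃ x, x ∈ (U : LowerSet X) := by
  constructor
  · intro h
    by_contra! hcon
    exact h (le_bot_iff.1 fun x hx => (hcon x hx).elim)
  · rintro ⟨x, hx⟩ rfl
    exact hx

/-- The map takes `x` to the least element of `B` containing it. Lifting works because, if no `s ≤
x` lay in `q`, then `x` would lie in `qᶜ`, and `q ≤ π x ≤ qᶜ` would force `q = ⊥`. -/
theorem exists_isProjection_positive {X : Type*} [Preorder X] {B : BooleanSubalgebra (RO X)}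
    (hreg : IsRegularSubalgebra B) (hcompl : IsCompleteOrder B) :
    ∃ π : X → Positive B, IsProjection π := by
  choose ρ hmem hleast using exists_least_mem_subalgebra hreg hcompl
  have hbot : ∀ b : B, b ≠ ⊥ ↔ ∃ x, x ∈ ((b : RO X) : LowerSet X) := fun b => by
    rw [← RO.ne_bot_iff, ne_eq, ne_eq, ← Subtype.coe_inj, BooleanSubalgebra.val_bot]
  refine ⟨fun x => ⟨ρ x, (hbot _).2 ⟨x, hmem x⟩⟩, fun x y h => ?_, fun x q hq => ?_, fun q => ?_⟩
  · exact hleast x _ (((ρ y : RO X) : LowerSet X).lower h (hmem y))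
  · suffices h : ∃ s ≤ x, s ∈ ((q.1 : RO X) : LowerSet X) from
      h.imp fun s hs => ⟨hs.1, hleast s _ hs.2⟩
    by_contra! hcon
    have h1 : ρ x ≤ q.1ᶜ := hleast x _ (by
      rw [BooleanSubalgebra.val_compl]
      exact RO.mem_compl_iff.2 hcon)
    have h2 : q.1 ≤ q.1ᶜ := le_trans hq h1
    exact q.2 (le_compl_self.1 h2)
  · obtain ⟨x, hx⟩ := (hbot _).1 q.2
    exact ⟨x, hleast x _ hx⟩

/-- The open dense sets are met one by one along a descent in `T`, where lower bounds exist. This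
makes the failing cardinal `κ` uncountable. -/
theorem IsProjection.exists_le_forall_mem {T Q ι : Type*} [Preorder T] [Preorder Q] [Countable ι]
    {π : T → Q} (hπ : IsProjection π) (hT : SigmaClosed T) {U : ι → Set Q}
    (hU : ∀ i, IsOpenDense (U i)) (q : Q) : ∃ r ≤ q, ∀ i, r ∈ U i := by
  rcases isEmpty_or_nonempty ι with he | hne
  · exact ⟨q, le_rfl, fun i => he.elim i⟩
  obtain ⟨e, he⟩ := exists_surjective_nat ι
  have hstep : ∀ (n : ℕ) (t : T), ∃ s ≤ t, π s ∈ U (e n) := fun n t => by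
    obtain ⟨r, hr, hrt⟩ := (hU (e n)).isCoinitial (π t)
    obtain ⟨s, hs, hsr⟩ := hπ.lift t r hrt
    exact ⟨s, hs, (hU (e n)).isLowerSet hsr hr⟩
  choose next hle hmem using hstep
  obtain ⟨t₀, ht₀⟩ := hπ.dense q
  let s : ℕ → T := fun n => n.rec t₀ next
  obtain ⟨t, ht⟩ := hT s (antitone_nat_of_succ_le fun n => hle n (s n))
  refine ⟨π t, (hπ.monotone (ht 0)).trans ht₀, fun i => ?_⟩
  obtain ⟨n, rfl⟩ := he i
  exact (hU (e n)).isLowerSet (hπ.monotone (ht (n + 1))) (hmem n (s n))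

/-! ### Maximal antichains and transfinite choices -/

theorem exists_maximal_antichain {Q : Type*} [Preorder Q] {U : Set Q} (hU : IsCoinitial U) :
    ∃ A ⊆ U, (∀ a ∈ A, ∀ b ∈ A, ∀ r, r ≤ a → r ≤ b → a = b) ∧
      ∀ q, ∃ a ∈ A, ∃ r, r ≤ a ∧ r ≤ q := by
  obtain ⟨A, hA⟩ := zorn_subset
    {A : Set Q | A ⊆ U ∧ ∀ a ∈ A, ∀ b ∈ A, ∀ r, r ≤ a → r ≤ b → a = b} (by
      intro C hC hchain
      refine ⟨⋃₀ C, ⟨Set.sUnion_subset fun A hA => (hC hA).1, ?_⟩,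
        fun A hA => Set.subset_sUnion_of_mem hA⟩
      rintro a ⟨A, hA, ha⟩ b ⟨A', hA', hb⟩ r hra hrb
      rcases hchain.total hA hA' with h | h
      · exact (hC hA').2 a (h ha) b hb r hra hrb
      · exact (hC hA).2 a ha b (h hb) r hra hrb)
  refine ⟨A, hA.prop.1, hA.prop.2, fun q => ?_⟩
  by_contra! hcon
  obtain ⟨p, hp, hpq⟩ := hU q
  have hmem : p ∈ A := by
    refine hA.le_of_ge (y := insert p A) ⟨Set.insert_subset hp hA.prop.1, ?_⟩
      (Set.subset_insert p A) (Set.mem_insert p A)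
    rintro a (rfl | ha) b (rfl | hb) r hra hrb
    · rfl
    · exact (hcon b hb r hrb (hra.trans hpq)).elim
    · exact (hcon a ha r hra (hrb.trans hpq)).elim
    · exact hA.prop.2 a ha b hb r hra hrb
  exact hcon p hmem p le_rfl hpq

/-- Recursion in which a next value is guaranteed only after a correct history: choose a solution
whenever there is one, then verify by induction that there always was. -/
theorem exists_forall_of_wellFounded {I L : Type*} [Preorder I] [WellFoundedLT I]
    (R : (i : I) → (Set.Iio i → L) → L → Prop)
    (h : ∀ (i : I) (f : Set.Iio i → L),
      (∀ j : Set.Iio i, R j (fun k => f ⟨k, lt_trans k.2 j.2⟩) (f j)) → ∃ x, R i f x) :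
    ∃ F : I → L, ∀ i, R i (fun j => F j) (F i) := by
  classical
  rcases isEmpty_or_nonempty L with hL | ⟨⟨x₀⟩⟩
  · rcases isEmpty_or_nonempty I with hI | ⟨⟨i⟩⟩
    · exact ⟨fun i => hI.elim i, fun i => hI.elim i⟩
    · have : ∀ i : I, False := fun i => by
        induction i using WellFoundedLT.induction with
        | ind i ih =>
          obtain ⟨x, -⟩ := h i (fun j => (ih j j.2).elim) (fun j => (ih j j.2).elim)
          exact hL.false x
      exact (this i).elim
  · let F : I → L := wellFounded_lt.fix fun i rec =>
      if h : ∃ x, R i (fun j => rec j j.2) x then h.choose else x₀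
    have hF : ∀ i, F i = if h : ∃ x, R i (fun j => F j) x then h.choose else x₀ := fun i =>
      wellFounded_lt.fix_eq _ i
    refine ⟨F, fun i => ?_⟩
    induction i using WellFoundedLT.induction with
    | ind i ih =>
      have hex := h i (fun j => F j) fun j => ih j j.2
      rw [hF i, dif_pos hex]
      exact hex.choose_spec

/-- Enumerate `E` in the order type of its cardinality; at each stage fewer than `κ` values have
been used. -/
theorem exists_injective_choice {E X : Type u} {κ : Cardinal.{u}} (S : E → Set X)
    (hE : #E ≤ κ) (hS : ∀ e, κ ≤ #(S e)) :
    ∃ f : E → X, Function.Injective f ∧ ∀ e, f e ∈ S e := by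
  obtain ⟨φ⟩ : Nonempty ((#E).ord.ToType ≃ E) := Cardinal.eq.1 (Cardinal.mk_ord_toType _)
  obtain ⟨F, hF⟩ := exists_forall_of_wellFounded
    (fun (i : (#E).ord.ToType) (f : Set.Iio i → X) x => x ∈ S (φ i) ∧ x ∉ Set.range f) (by
      intro i f _
      by_contra! hcon
      have h1 : #(S (φ i)) ≤ #(Set.Iio i) :=
        (Cardinal.mk_le_mk_of_subset hcon).trans Cardinal.mk_range_le
      have h2 : #(Set.Iio i) < #(#E).ord.ToType := Cardinal.mk_Iio_lt i (by simp)
      rw [Cardinal.mk_ord_toType] at h2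
      exact absurd ((hS _).trans h1) (not_le.2 (h2.trans_le hE)))
  refine ⟨fun e => F (φ.symm e), fun a b hab => φ.symm.injective ?_, fun e => ?_⟩
  · rcases lt_trichotomy (φ.symm a) (φ.symm b) with h | h | h
    · exact ((hF (φ.symm b)).2 ⟨⟨_, h⟩, hab⟩).elim
    · exact h
    · exact ((hF (φ.symm a)).2 ⟨⟨_, h⟩, hab.symm⟩).elim
  · simpa using (hF (φ.symm e)).1

/-! ### Constructing one level of the base tree -/

/-- `x.1` is a maximal antichain contained in the open set `O` and refining the antichains
`(f j).1`; each of its elements `a` comes with a set `x.2 a` of witnesses in `T`. -/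
structure IsLevel {T Q J : Type u} [Preorder T] [Preorder Q] (π : T → Q) (O : Set Q)
    (f : J → Set Q × (Q → Set T)) (x : Set Q × (Q → Set T)) : Prop where
  eq_of_le : ∀ a ∈ x.1, ∀ b ∈ x.1, ∀ r, r ≤ a → r ≤ b → a = b
  predense : ∀ q, ∃ a ∈ x.1, ∃ r, r ≤ a ∧ r ≤ q
  refines : ∀ a ∈ x.1, ∀ j, ∃ b ∈ (f j).1, a ≤ b
  subset : x.1 ⊆ O
  witness_nonempty : ∀ a ∈ x.1, (x.2 a).Nonempty
  le_witness : ∀ a ∈ x.1, ∀ t ∈ x.2 a, a ≤ π t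
  mk_witness_le : ∀ a ∈ x.1, #(x.2 a) ≤ max ℵ₀ #J
  witness_extends : ∀ a ∈ x.1, ∀ j, ∀ b ∈ (f j).1, a ≤ b → ∀ t ∈ (f j).2 b,
    ∃ s ∈ x.2 a, s ≤ t ∧ π s ≤ b
  exists_le : ∀ t j, 𝔠 ≤ #{a | a ∈ (f j).1 ∧ ∃ r, r ≤ a ∧ r ≤ π t} → ∃ a ∈ x.1, a ≤ π t

section ExistsLevel

variable {T Q J : Type u} [Preorder T] [Preorder Q] {π : T → Q} {κ : Cardinal.{u}}

/-- The elements that can be put into the next level. -/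
def levelCandidates (π : T → Q) (O : Set Q) (f : J → Set Q × (Q → Set T)) : Set Q :=
  {q | q ∈ O ∧ (∀ j, ∃ b ∈ (f j).1, q ≤ b) ∧ ∃ W : Set T, W.Nonempty ∧ (∀ t ∈ W, q ≤ π t) ∧
    #W ≤ max ℵ₀ #J ∧ ∀ j, ∀ b ∈ (f j).1, q ≤ b → ∀ t ∈ (f j).2 b, ∃ s ∈ W, s ≤ t ∧ π s ≤ b}

theorem isOpenDense_below {A : Set Q} (h : ∀ q, ∃ a ∈ A, ∃ r, r ≤ a ∧ r ≤ q) :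
    IsOpenDense {q | ∃ a ∈ A, q ≤ a} where
  isLowerSet := fun _ _ hqp ⟨a, ha, hp⟩ => ⟨a, ha, hqp.trans hp⟩
  isCoinitial := fun q => by
    obtain ⟨a, ha, r, hra, hrq⟩ := h q
    exact ⟨r, ⟨a, ha, hra⟩, hrq⟩

/-- Distributivity below `κ` is used twice: to enter all earlier antichains, and then to find one
element below an extension of every earlier witness. The bound on witness sets keeps the second
family smaller than `κ`. -/
theorem isOpenDense_levelCandidates (hπ : IsProjection π)
    (hdist : ∀ (ι : Type u) (U : ι → Set Q), #ι < κ → (∀ i, IsOpenDense (U i)) →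
      IsCoinitial (⋂ i, U i))
    (hκ : ℵ₀ < κ) (hJ : #J < κ) {O : Set Q} (hO : IsOpenDense O)
    {f : J → Set Q × (Q → Set T)}
    (heq : ∀ j, ∀ a ∈ (f j).1, ∀ b ∈ (f j).1, ∀ r, r ≤ a → r ≤ b → a = b)
    (hpre : ∀ j q, ∃ a ∈ (f j).1, ∃ r, r ≤ a ∧ r ≤ q)
    (hle : ∀ j, ∀ a ∈ (f j).1, ∀ t ∈ (f j).2 a, a ≤ π t)
    (hcard : ∀ j, ∀ a ∈ (f j).1, #((f j).2 a) ≤ max ℵ₀ #J) :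
    IsOpenDense (levelCandidates π O f) where
  isLowerSet := by
    rintro p q hqp ⟨hpO, hpref, W, hW, hpW, hWc, hWe⟩
    refine ⟨hO.isLowerSet hqp hpO, fun j => (hpref j).imp fun b hb => ⟨hb.1, hqp.trans hb.2⟩,
      W, hW, fun t ht => hqp.trans (hpW t ht), hWc, fun j b hb hqb => ?_⟩
    obtain ⟨b', hb', hpb'⟩ := hpref j
    rw [heq j b hb b' hb' q hqb (hqp.trans hpb')]
    exact hWe j b' hb' hpb'
  isCoinitial := by
    intro q
    obtain ⟨q₀, hq₀O, hq₀⟩ := hO.isCoinitial q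
    obtain ⟨q₁, hq₁, hq₁q⟩ := hdist J (fun j => {q | ∃ a ∈ (f j).1, q ≤ a}) hJ
      (fun j => isOpenDense_below (hpre j)) q₀
    rw [Set.mem_iInter] at hq₁
    choose a ha hqa using hq₁
    let K := Σ j, (f j).2 (a j)
    have hK : #K ≤ max ℵ₀ #J := by
      rw [Cardinal.mk_sigma]
      calc Cardinal.sum (fun j => #((f j).2 (a j)))
          ≤ Cardinal.sum (fun _ : J => max ℵ₀ #J) :=
            Cardinal.sum_le_sum _ _ fun j => hcard j _ (ha j)
        _ = #J * max ℵ₀ #J := Cardinal.sum_const' _ _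
        _ ≤ max ℵ₀ #J * max ℵ₀ #J := by gcongr; exact le_max_right _ _
        _ = max ℵ₀ #J := Cardinal.mul_eq_self (le_max_left _ _)
    -- The incompatibility alternative makes these sets dense everywhere, not just below `q₁`; it
    -- cannot occur for `q₂ ≤ q₁`.
    obtain ⟨q₂, hq₂, hq₂q⟩ := hdist K
      (fun k => {q | (∃ s ≤ k.2.1, q ≤ π s ∧ π s ≤ a k.1) ∨ Incompatible q q₁})
      (hK.trans_lt (max_lt hκ hJ)) (fun k => by
        constructor
        · rintro p q hqp (⟨s, hs, hps, hsa⟩ | hinc)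
          · exact Or.inl ⟨s, hs, hqp.trans hps, hsa⟩
          · exact Or.inr fun ⟨r, hr, hr'⟩ => hinc ⟨r, hr.trans hqp, hr'⟩
        · intro p
          by_cases hinc : Incompatible p q₁
          · exact ⟨p, Or.inr hinc, le_rfl⟩
          · obtain ⟨r, hrp, hrq⟩ := not_not.1 hinc
            obtain ⟨s, hs, hsr⟩ := hπ.lift k.2.1 r
              ((hrq.trans (hqa k.1)).trans (hle _ _ (ha k.1) _ k.2.2))
            exact ⟨π s, Or.inl ⟨s, hs, le_rfl, hsr.trans (hrq.trans (hqa k.1))⟩,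
              hsr.trans hrp⟩) q₁
    rw [Set.mem_iInter] at hq₂
    have hq₂' : ∀ k : K, ∃ s ≤ k.2.1, q₂ ≤ π s ∧ π s ≤ a k.1 := fun k =>
      (hq₂ k).resolve_right fun hinc => hinc ⟨q₂, le_rfl, hq₂q⟩
    choose s hst hqs hsa using hq₂'
    obtain ⟨t₀, ht₀⟩ := hπ.dense q₂
    -- Inserting `t₀` keeps the witness set nonempty at the first level, where there is nothing to
    -- extend.
    refine ⟨π t₀, ⟨hO.isLowerSet ((ht₀.trans hq₂q).trans hq₁q) hq₀O,
      fun j => ⟨a j, ha j, (ht₀.trans hq₂q).trans (hqa j)⟩,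
      insert t₀ (Set.range s), Set.insert_nonempty _ _, ?_, ?_, ?_⟩,
      ((ht₀.trans hq₂q).trans hq₁q).trans hq₀⟩
    · rintro _ (rfl | ⟨k, rfl⟩)
      · exact le_rfl
      · exact ht₀.trans (hqs k)
    · refine (Cardinal.mk_insert_le).trans ?_
      exact Cardinal.add_le_of_le (le_max_left _ _) (Cardinal.mk_range_le.trans hK)
        (Cardinal.one_le_aleph0.trans (le_max_left _ _))
    · intro j b hb hqb t ht
      obtain rfl : b = a j := heq j b hb _ (ha j) _ hqb ((ht₀.trans hq₂q).trans (hqa j))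
      exact ⟨s ⟨j, t, ht⟩, Or.inr ⟨_, rfl⟩, hst ⟨j, t, ht⟩, hsa ⟨j, t, ht⟩⟩

/-- Each `t` that was rich at an earlier level is still compatible with `𝔠` members of a maximal
antichain `A` of candidates, so distinct `t` can be assigned distinct members. Each assigned member
is then refined to decide only its own `π t`. -/
theorem exists_isLevel (hπ : IsProjection π) (hT : #T ≤ 𝔠)
    (hdist : ∀ (ι : Type u) (U : ι → Set Q), #ι < κ → (∀ i, IsOpenDense (U i)) →
      IsCoinitial (⋂ i, U i))
    (hκ : ℵ₀ < κ) (hJ : #J < κ) {O : Set Q} (hO : IsOpenDense O)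
    {f : J → Set Q × (Q → Set T)}
    (heq : ∀ j, ∀ a ∈ (f j).1, ∀ b ∈ (f j).1, ∀ r, r ≤ a → r ≤ b → a = b)
    (hpre : ∀ j q, ∃ a ∈ (f j).1, ∃ r, r ≤ a ∧ r ≤ q)
    (hle : ∀ j, ∀ a ∈ (f j).1, ∀ t ∈ (f j).2 a, a ≤ π t)
    (hcard : ∀ j, ∀ a ∈ (f j).1, #((f j).2 a) ≤ max ℵ₀ #J) :
    ∃ x, IsLevel π O f x := by
  have hV := isOpenDense_levelCandidates hπ hdist hκ hJ hO heq hpre hle hcard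
  obtain ⟨A, hAV, hAeq, hApre⟩ := exists_maximal_antichain hV.isCoinitial
  let E := {t : T // ∃ j, 𝔠 ≤ #{a | a ∈ (f j).1 ∧ ∃ r, r ≤ a ∧ r ≤ π t}}
  obtain ⟨g, hg, hgA⟩ := exists_injective_choice (κ := 𝔠)
    (fun t : E => {a | a ∈ A ∧ ∃ r, r ≤ a ∧ r ≤ π t.1}) ((Cardinal.mk_subtype_le _).trans hT) (by
      rintro ⟨t, j, hj⟩
      refine hj.trans ?_
      have h : ∀ b : {a | a ∈ (f j).1 ∧ ∃ r, r ≤ a ∧ r ≤ π t},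
          ∃ a : {a | a ∈ A ∧ ∃ r, r ≤ a ∧ r ≤ π t}, a.1 ≤ b.1 := by
        rintro ⟨b, hb, r, hrb, hrt⟩
        obtain ⟨a, ha, p, hpa, hpr⟩ := hApre r
        refine ⟨⟨a, ha, p, hpa, hpr.trans hrt⟩, ?_⟩
        obtain ⟨b', hb', hab'⟩ := (hAV ha).2.1 j
        exact hab'.trans (heq j b hb b' hb' p (hpr.trans hrb) (hpa.trans hab')).ge
      choose φ hφ using h
      -- An element of `A` lies below only one member of the earlier antichain, so the chosen
      -- refinements are distinct.
      refine Cardinal.mk_le_of_injective (f := φ) fun b b' hbb => Subtype.ext ?_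
      exact heq j _ b.2.1 _ b'.2.1 _ (hφ b) (hbb ▸ hφ b'))
  have hU : IsCoinitial {q | ∃ a ∈ A, q ≤ a ∧
      ∀ t : E, g t = a → q ≤ π t.1 ∨ Incompatible q (π t.1)} := by
    intro q
    obtain ⟨a, ha, r, hra, hrq⟩ := hApre q
    by_cases h : ∃ t : E, g t = a ∧ ¬ Incompatible r (π t.1)
    · obtain ⟨t, rfl, ht⟩ := h
      obtain ⟨p, hpr, hpt⟩ := not_not.1 ht
      exact ⟨p, ⟨g t, ha, hpr.trans hra, fun t' ht' => Or.inl (hg ht' ▸ hpt)⟩, hpr.trans hrq⟩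
    · push Not at h
      exact ⟨r, ⟨a, ha, hra, fun t ht => Or.inr (h t ht)⟩, hrq⟩
  obtain ⟨A', hA'U, hA'eq, hA'pre⟩ := exists_maximal_antichain hU
  have hA'V : A' ⊆ levelCandidates π O f := fun q hq => by
    obtain ⟨a, ha, hqa, -⟩ := hA'U hq
    exact hV.isLowerSet hqa (hAV ha)
  have hW : ∀ q, ∃ W : Set T, q ∈ levelCandidates π O f → W.Nonempty ∧ (∀ t ∈ W, q ≤ π t) ∧
      #W ≤ max ℵ₀ #J ∧ ∀ j, ∀ b ∈ (f j).1, q ≤ b → ∀ t ∈ (f j).2 b,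
        ∃ s ∈ W, s ≤ t ∧ π s ≤ b := fun q => by
    by_cases hq : q ∈ levelCandidates π O f
    · obtain ⟨W, hW⟩ := hq.2.2
      exact ⟨W, fun _ => hW⟩
    · exact ⟨∅, fun h => (hq h).elim⟩
  choose W hW using hW
  refine ⟨(A', W), hA'eq, hA'pre, fun a ha => (hA'V ha).2.1, fun a ha => (hA'V ha).1,
    fun a ha => (hW a (hA'V ha)).1, fun a ha => (hW a (hA'V ha)).2.1,
    fun a ha => (hW a (hA'V ha)).2.2.1, fun a ha => (hW a (hA'V ha)).2.2.2, fun t j hj => ?_⟩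
  obtain ⟨hgt, r, hrg, hrt⟩ := hgA ⟨t, j, hj⟩
  obtain ⟨a, ha, p, hpa, hpr⟩ := hA'pre r
  obtain ⟨b, hb, hab, hbt⟩ := hA'U ha
  refine ⟨a, ha, (hbt ⟨t, j, hj⟩ ?_).resolve_right fun hinc => hinc ⟨p, hpa, hpr.trans hrt⟩⟩
  exact hAeq _ hgt b hb p (hpr.trans hrg) (hpa.trans hab)

end ExistsLevel

/-! ### Density and σ-closedness of the union of the levels -/

section Tree

variable {T Q I : Type u} [Preorder T] [Preorder Q] [LinearOrder I] {π : T → Q}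
  {O : I → Set Q} {F : I → Set Q × (Q → Set T)}

theorem IsLevel.exists_ge_of_le (hF : ∀ i, IsLevel π (O i) (fun j : Set.Iio i => F j) (F i))
    {i j : I} (hij : i ≤ j) {a : Q} (ha : a ∈ (F j).1) : ∃ b ∈ (F i).1, a ≤ b := by
  rcases hij.eq_or_lt with rfl | hij
  · exact ⟨a, ha, le_rfl⟩
  · exact (hF j).refines a ha ⟨i, hij⟩

theorem IsLevel.exists_le_of_rich [NoMaxOrder I]
    (hF : ∀ i, IsLevel π (O i) (fun j : Set.Iio i => F j) (F i)) {t : T} {i : I}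
    (h : 𝔠 ≤ #{a | a ∈ (F i).1 ∧ ∃ r, r ≤ a ∧ r ≤ π t}) :
    ∃ j, ∃ a ∈ (F j).1, a ≤ π t := by
  obtain ⟨j, hj⟩ := exists_gt i
  exact ⟨j, (hF j).exists_le t ⟨i, hj⟩ h⟩

/-- Take a level whose open set omits `π t`. No member of it lies above `π t`, so by separativity `π
t` is compatible with at least two members. -/
theorem IsLevel.exists_split (hπ : IsProjection π) (hsep : SeparativeOrder Q)
    (hO : ∀ i, IsLowerSet (O i)) (hempty : ∀ q, ∃ i, q ∉ O i)
    (hF : ∀ i, IsLevel π (O i) (fun j : Set.Iio i => F j) (F i)) (t : T) :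
    ∃ i, ∃ s : Bool → T, ∃ a : Bool → Q, (∀ b, s b ≤ t) ∧ (∀ b, a b ∈ (F i).1) ∧
      (∀ b, π (s b) ≤ a b) ∧ Function.Injective a := by
  obtain ⟨i, hi⟩ := hempty (π t)
  have key : ∀ q ≤ π t, ∃ a ∈ (F i).1, ∃ s ≤ t, π s ≤ a ∧ π s ≤ q := fun q hq => by
    obtain ⟨a, ha, r, hra, hrq⟩ := (hF i).predense q
    obtain ⟨s, hs, hsr⟩ := hπ.lift t r (hrq.trans hq)
    exact ⟨a, ha, s, hs, hsr.trans hra, hsr.trans hrq⟩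
  obtain ⟨a, ha, s, hs, hsa, -⟩ := key (π t) le_rfl
  obtain ⟨r, hr, hra⟩ := hsep (π t) a fun h => hi (hO i h ((hF i).subset ha))
  obtain ⟨a', ha', s', hs', hsa', hsr'⟩ := key r hr
  have hne : a ≠ a' := by
    rintro rfl
    exact hra ⟨π s', hsr', hsa'⟩
  refine ⟨i, fun b => cond b s s', fun b => cond b a a', ?_, ?_, ?_, ?_⟩
  · rintro (_ | _) <;> assumption
  · rintro (_ | _) <;> assumption
  · rintro (_ | _) <;> assumption
  · rintro (_ | _) (_ | _) h
    · rfl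
    · exact (hne h.symm).elim
    · exact (hne h).elim
    · rfl

/-- Were the indices cofinal, countable distributivity would give an element below members of
cofinally many levels, hence in every `O i`. -/
theorem IsLevel.exists_upper_bound (hπ : IsProjection π) (hT : SigmaClosed T)
    (hO : ∀ i, IsLowerSet (O i)) (hempty : ∀ q, ∃ i, q ∉ O i)
    (hF : ∀ i, IsLevel π (O i) (fun j : Set.Iio i => F j) (F i)) (t : T)
    {ι : Type*} [Countable ι] (c : ι → I) : ∃ l, ∀ n, c n ≤ l := by
  by_contra! hcon
  obtain ⟨r, -, hr⟩ := hπ.exists_le_forall_mem hT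
    (fun n => isOpenDense_below (hF (c n)).predense) (π t)
  obtain ⟨i, hi⟩ := hempty r
  obtain ⟨n, hn⟩ := hcon i
  obtain ⟨a, ha, hra⟩ := hr n
  obtain ⟨b, hb, hab⟩ := IsLevel.exists_ge_of_le hF hn.le ha
  exact hi (hO i (hra.trans hab) ((hF i).subset hb))

/-- Iterated splitting grows a binary tree of nodes below `t`. Its countably many nodes use levels
bounded by a single `l`, and the `𝔠` branches have lower bounds in `T`, which lead to distinct
members of level `l`. -/
theorem IsLevel.exists_rich (hπ : IsProjection π) (hT : SigmaClosed T)
    (hsep : SeparativeOrder Q) (hO : ∀ i, IsLowerSet (O i)) (hempty : ∀ q, ∃ i, q ∉ O i)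
    (hF : ∀ i, IsLevel π (O i) (fun j : Set.Iio i => F j) (F i)) (t : T) :
    ∃ i, 𝔠 ≤ #{a | a ∈ (F i).1 ∧ ∃ r, r ≤ a ∧ r ≤ π t} := by
  choose lev ch top hch htop hle hinj using IsLevel.exists_split hπ hsep hO hempty hF
  let node : List Bool → T := fun w => w.foldl ch t
  let path : (ℕ → Bool) → ℕ → T := fun x n => node ((List.range n).map x)
  have hsucc : ∀ x n, path x (n + 1) = ch (path x n) (x n) := fun x n => by
    simp only [path, node, List.range_succ, List.map_append, List.foldl_append, List.map_cons,
      List.map_nil, List.foldl_cons, List.foldl_nil]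
  have hpath : ∀ x y n, (∀ k < n, x k = y k) → path x n = path y n := fun x y n h => by
    simp only [path]
    rw [List.map_congr_left fun k hk => h k (List.mem_range.1 hk)]
  obtain ⟨l, hl⟩ := IsLevel.exists_upper_bound hπ hT hO hempty hF t fun w => lev (node w)
  have hlim : ∀ x, ∃ s, ∀ n, s ≤ path x n := fun x =>
    hT (path x) (antitone_nat_of_succ_le fun n => hsucc x n ▸ hch (path x n) (x n))
  choose lim hlim using hlim
  choose g hg r hrg hrl using fun x => (hF l).predense (π (lim x))
  have hbelow : ∀ x n, g x ≤ top (path x n) (x n) := fun x n => by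
    obtain ⟨b, hb, hgb⟩ := IsLevel.exists_ge_of_le hF (hl ((List.range n).map x)) (hg x)
    have h1 : r x ≤ top (path x n) (x n) := (hrl x).trans
      ((hπ.monotone ((hlim x (n + 1)).trans (hsucc x n).le)).trans (hle _ _))
    exact hgb.trans ((hF _).eq_of_le b hb _ (htop (path x n) (x n)) (r x)
      ((hrg x).trans hgb) h1).le
  have hginj : Function.Injective g := by
    intro x y hxy
    by_contra hne
    have hex : ∃ n, x n ≠ y n := Function.ne_iff.1 hne
    classical
    have hmin : ∀ k < Nat.find hex, x k = y k := fun k hk => not_not.1 (Nat.find_min hex hk)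
    have h1 := hbelow x (Nat.find hex)
    have h2 := hbelow y (Nat.find hex)
    rw [← hpath x y _ hmin, ← hxy] at h2
    exact Nat.find_spec hex (hinj _ ((hF _).eq_of_le _ (htop _ _) _ (htop _ _) _ h1 h2))
  refine ⟨l, ?_⟩
  have := Cardinal.lift_mk_le_lift_mk_of_injective
    (f := fun x => (⟨g x, hg x, r x, hrg x, (hrl x).trans (hπ.monotone (hlim x 0))⟩ :
      {a | a ∈ (F l).1 ∧ ∃ r, r ≤ a ∧ r ≤ π t}))
    fun x y h => hginj (congrArg Subtype.val h)
  have hc : Cardinal.lift.{u, 0} #(ℕ → Bool) = 𝔠 := by simp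
  rwa [hc, Cardinal.lift_uzero] at this

/-- If a greatest level index is attained, at `s m` say, the sequence cannot drop below `s m`
afterwards. Otherwise pass to a subsequence with strictly increasing levels and follow witnesses
down it: a lower bound of the witnesses projects below the whole sequence, and density returns to
the union. -/
theorem IsLevel.sigmaClosed_iUnion (hπ : IsProjection π) (hT : SigmaClosed T)
    (hF : ∀ i, IsLevel π (O i) (fun j : Set.Iio i => F j) (F i))
    (hdense : IsCoinitial (⋃ i, (F i).1)) : SigmaClosed (⋃ i, (F i).1) := by
  intro s hs
  choose l hl using fun n => Set.mem_iUnion.1 (s n).2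
  by_cases hmax : ∃ m, ∀ n, l n ≤ l m
  · obtain ⟨m, hm⟩ := hmax
    refine ⟨s m, fun n => ?_⟩
    rcases le_total n m with h | h
    · exact hs h
    · obtain ⟨b, hb, hmb⟩ := IsLevel.exists_ge_of_le hF (hm n) (hl m)
      have hnm : ((s n : _) : Q) ≤ s m := hs h
      have := (hF (l n)).eq_of_le _ (hl n) b hb (s n) le_rfl (hnm.trans hmb)
      exact Subtype.coe_le_coe.1 (hmb.trans this.ge)
  · push Not at hmax
    have hbig : ∀ N, ∃ n, ∀ j ≤ N, l j < l n := fun N => by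
      obtain ⟨m, -, hm⟩ := Finset.exists_max_image (Finset.range (N + 1)) l
        ⟨0, Finset.mem_range.2 N.succ_pos⟩
      obtain ⟨n, hn⟩ := hmax m
      exact ⟨n, fun j hj => (hm j (Finset.mem_range.2 (by omega))).trans_lt hn⟩
    choose next hnext using hbig
    have hgt : ∀ N, N < next N := fun N => by
      by_contra! h
      exact lt_irrefl _ (hnext N _ h)
    let φ : ℕ → ℕ := fun n => n.rec 0 fun _ => next
    have hφ : ∀ n, n ≤ φ n := fun n => by
      induction n with
      | zero => exact le_rfl
      | succ n ih => exact Nat.succ_le_of_lt (ih.trans_lt (hgt (φ n)))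
    have hstep : ∀ n, ∀ t ∈ (F (l (φ n))).2 (s (φ n)),
        ∃ t' ∈ (F (l (φ (n + 1)))).2 (s (φ (n + 1))), t' ≤ t ∧ π t' ≤ s (φ n) := fun n t ht =>
      (hF (l (φ (n + 1)))).witness_extends _ (hl _) ⟨l (φ n), hnext (φ n) _ le_rfl⟩ _ (hl _)
        (hs (hgt (φ n)).le) t ht
    choose! w hw hwle hwπ using hstep
    obtain ⟨t₀, ht₀⟩ := (hF (l (φ 0))).witness_nonempty _ (hl (φ 0))
    let τ : ℕ → T := fun n => n.rec t₀ w
    have hτ : ∀ n, τ n ∈ (F (l (φ n))).2 (s (φ n)) := fun n => by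
      induction n with
      | zero => exact ht₀
      | succ n ih => exact hw n _ ih
    obtain ⟨t, ht⟩ := hT τ (antitone_nat_of_succ_le fun n => hwle n _ (hτ n))
    obtain ⟨d, hd, hdt⟩ := hdense (π t)
    refine ⟨⟨d, hd⟩, fun n => ?_⟩
    have h1 : d ≤ s (φ n) :=
      hdt.trans ((hπ.monotone (ht (n + 1))).trans (hwπ n _ (hτ n)))
    exact Subtype.coe_le_coe.1 (h1.trans (hs (hφ n)))

end Tree

/-- A separative image under projection of a `σ`-closed preorder of size at most continuum has a
`σ`-closed dense subset, provided that its failure of distributivity is homogeneous. -/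
theorem exists_sigmaClosed_of_homogeneous {T Q : Type u} [Preorder T] [Preorder Q] {π : T → Q}
    (hπ : IsProjection π) (hT : SigmaClosed T) (hcard : #T ≤ 𝔠) (hsep : SeparativeOrder Q)
    {κ : Cardinal.{u}} (hκ : ℵ₀ < κ)
    (hdist : ∀ (ι : Type u) (U : ι → Set Q), #ι < κ → (∀ i, IsOpenDense (U i)) →
      IsCoinitial (⋂ i, U i))
    (O : κ.ord.ToType → Set Q) (hO : ∀ i, IsOpenDense (O i)) (hempty : ∀ q, ∃ i, q ∉ O i) :
    ∃ D : Set Q, IsCoinitial D ∧ SigmaClosed D := by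
  have : NoMaxOrder κ.ord.ToType := Cardinal.noMaxOrder hκ.le
  have hlt : ∀ i : κ.ord.ToType, #(Set.Iio i) < κ := fun i => by
    have := Cardinal.mk_Iio_lt i (by simp)
    rwa [Cardinal.mk_ord_toType] at this
  obtain ⟨F, hF⟩ := exists_forall_of_wellFounded
    (fun (i : κ.ord.ToType) (f : Set.Iio i → Set Q × (Q → Set T)) x => IsLevel π (O i) f x) (by
      intro i f hf
      refine exists_isLevel hπ hcard hdist hκ (hlt i) (hO i) (fun j => (hf j).eq_of_le)
        (fun j => (hf j).predense) (fun j => (hf j).le_witness) fun j a ha =>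
          ((hf j).mk_witness_le a ha).trans (max_le_max le_rfl ?_)
      exact Cardinal.mk_le_mk_of_subset (Set.Iio_subset_Iio j.2.le))
  have hdense : IsCoinitial (⋃ i, (F i).1) := fun q => by
    obtain ⟨t, ht⟩ := hπ.dense q
    obtain ⟨i, hi⟩ := IsLevel.exists_rich hπ hT hsep (fun i => (hO i).isLowerSet) hempty hF t
    obtain ⟨j, a, ha, hat⟩ := IsLevel.exists_le_of_rich hF hi
    exact ⟨a, Set.mem_iUnion.2 ⟨j, ha⟩, hat.trans ht⟩
  exact ⟨_, hdense, IsLevel.sigmaClosed_iUnion hπ hT hF hdense⟩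

/-! ### Localization below an element, gluing and part (2) -/

theorem IsProjection.restrict_Iic {T Q : Type*} [Preorder T] [Preorder Q] {π : T → Q}
    (hπ : IsProjection π) (b : Q) :
    IsProjection (fun t : {t // π t ≤ b} => (⟨π t, t.2⟩ : Set.Iic b)) where
  monotone := fun _ _ h => hπ.monotone h
  lift := fun t q hq => by
    obtain ⟨s, hs, hsq⟩ := hπ.lift t q hq
    exact ⟨⟨s, hsq.trans q.2⟩, hs, hsq⟩
  dense := fun q => by
    obtain ⟨t, ht⟩ := hπ.dense q
    exact ⟨⟨t, ht.trans q.2⟩, ht⟩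

theorem SigmaClosed.subtype_isLowerSet {T : Type*} [Preorder T] (hT : SigmaClosed T)
    {U : Set T} (hU : IsLowerSet U) : SigmaClosed U := by
  intro s hs
  obtain ⟨t, ht⟩ := hT (fun n => s n) hs
  exact ⟨⟨t, hU (ht 0) (s 0).2⟩, ht⟩

theorem SeparativeOrder.Iic {Q : Type*} [Preorder Q] (hQ : SeparativeOrder Q) (b : Q) :
    SeparativeOrder (Set.Iic b) := by
  intro p q hpq
  obtain ⟨r, hr, hrq⟩ := hQ p q hpq
  exact ⟨⟨r, hr.trans p.2⟩, hr, fun ⟨x, h1, h2⟩ => hrq ⟨x, h1, h2⟩⟩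

/-- The sizes of families of open dense sets without a common element below some `q ≤ q₀`. -/
def nondistributiveCardinals {Q : Type u} [Preorder Q] (q₀ : Q) : Set Cardinal.{u} :=
  {κ | ∃ (ι : Type u) (U : ι → Set Q), #ι = κ ∧ (∀ i, IsOpenDense (U i)) ∧
    ∃ q ≤ q₀, ∀ r ≤ q, ∃ i, r ∉ U i}

/-- For each `p`, the elements not above `p` form an open dense set by atomlessness, and no `r` lies
in the one indexed by `r` itself. -/
theorem nondistributiveCardinals_nonempty {Q : Type u} [Preorder Q] (hQ : AtomlessOrder Q)
    (q₀ : Q) : (nondistributiveCardinals q₀).Nonempty := by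
  refine ⟨#Q, Q, fun p => {r | ¬ p ≤ r}, rfl, fun p => ⟨fun r s hsr hr hs => hr (hs.trans hsr),
    fun q => ?_⟩, q₀, le_rfl, fun r _ => ⟨r, fun h => h le_rfl⟩⟩
  obtain ⟨q₁, q₂, h1, h2, hinc⟩ := hQ q
  by_cases h : p ≤ q₁
  · exact ⟨q₂, fun h' => hinc ⟨p, h, h'⟩, h2⟩
  · exact ⟨q₁, h, h1⟩

/-- Choose `b` to witness the least failing cardinal `κ` below `q₀`. Smaller families remain
distributive below `b`, while one family of size `κ` has no common element anywhere below `b`. -/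
theorem exists_sigmaClosed_dense_below {T Q : Type u} [Preorder T] [Preorder Q] {π : T → Q}
    (hπ : IsProjection π) (hT : SigmaClosed T) (hcard : #T ≤ 𝔠) (hsep : SeparativeOrder Q)
    (hatomless : AtomlessOrder Q) (q₀ : Q) :
    ∃ b ≤ q₀, ∃ D : Set Q, (∀ d ∈ D, d ≤ b) ∧ (∀ q ≤ b, ∃ d ∈ D, d ≤ q) ∧ SigmaClosed D := by
  obtain ⟨ι, U, hι, hU, b, hb, hbU⟩ :=
    csInf_mem (nondistributiveCardinals_nonempty hatomless q₀)
  set κ := sInf (nondistributiveCardinals q₀)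
  refine ⟨b, hb, ?_⟩
  have hκ₀ : ℵ₀ < κ := by
    by_contra! h
    have : Countable ι := by rwa [← Cardinal.mk_le_aleph0_iff, hι]
    obtain ⟨r, hr, hrU⟩ := hπ.exists_le_forall_mem hT hU b
    obtain ⟨i, hi⟩ := hbU r hr
    exact hi (hrU i)
  obtain ⟨φ⟩ : Nonempty (κ.ord.ToType ≃ ι) := Cardinal.eq.1 (by rw [Cardinal.mk_ord_toType, hι])
  obtain ⟨D, hD, hDclosed⟩ := exists_sigmaClosed_of_homogeneous (hπ.restrict_Iic b)
    (hT.subtype_isLowerSet (U := {t | π t ≤ b}) fun s t hts hs => (hπ.monotone hts).trans hs)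
    ((Cardinal.mk_subtype_le _).trans hcard) (hsep.Iic b) hκ₀ (by
      intro ι' V hι' hV q
      by_contra! hcon
      -- Adding the elements incompatible with `b` turns open dense subsets of the cone below `b`
      -- into open dense subsets of `Q`.
      refine notMem_of_lt_csInf' hι' ⟨ι', fun i => {p | (∃ h : p ≤ b, (⟨p, h⟩ : Set.Iic b) ∈ V i) ∨
        Incompatible p b}, rfl, fun i => ⟨?_, fun p => ?_⟩, q, q.2.trans hb, fun r hr => ?_⟩
      · rintro p p' hp (⟨h, hpV⟩ | hinc)
        · exact Or.inl ⟨hp.trans h, (hV i).isLowerSet (show (⟨p', hp.trans h⟩ : Set.Iic b) ≤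
            ⟨p, h⟩ from hp) hpV⟩
        · exact Or.inr fun ⟨x, h1, h2⟩ => hinc ⟨x, h1.trans hp, h2⟩
      · by_cases hinc : Incompatible p b
        · exact ⟨p, Or.inr hinc, le_rfl⟩
        · obtain ⟨x, hxp, hxb⟩ := not_not.1 hinc
          obtain ⟨y, hy, hyx⟩ := (hV i).isCoinitial ⟨x, hxb⟩
          exact ⟨y, Or.inl ⟨y.2, hy⟩, le_trans (show (y : Q) ≤ x from hyx) hxp⟩
      · by_contra! hr'
        refine hcon ⟨r, hr.trans q.2⟩ (Set.mem_iInter.2 fun i => ?_) hr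
        rcases hr' i with ⟨_, h⟩ | hinc
        · exact h
        · exact (hinc ⟨r, le_rfl, hr.trans q.2⟩).elim)
    (fun i => {q | (q : Q) ∈ U (φ i)}) (fun i => ⟨fun p q hqp hp => (hU _).isLowerSet hqp hp,
      fun q => by
        obtain ⟨r, hr, hrq⟩ := (hU (φ i)).isCoinitial q
        exact ⟨⟨r, hrq.trans q.2⟩, hr, hrq⟩⟩)
    (fun q => by
      obtain ⟨i, hi⟩ := hbU q q.2
      exact ⟨φ.symm i, by simpa using hi⟩)
  refine ⟨Subtype.val '' D, ?_, fun q hq => ?_, fun s hs => ?_⟩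
  · rintro _ ⟨d, -, rfl⟩
    exact d.2
  · obtain ⟨d, hd, hdq⟩ := hD ⟨q, hq⟩
    exact ⟨d, ⟨d, hd, rfl⟩, hdq⟩
  · choose d hd hds using fun n => (s n).2
    obtain ⟨e, he⟩ := hDclosed (fun n => ⟨d n, hd n⟩) fun m n hmn => by
      have : ((s n : _) : Q) ≤ s m := hs hmn
      rw [← hds, ← hds] at this
      exact this
    refine ⟨⟨e.1, e.1, e.2, rfl⟩, fun n => ?_⟩
    have h1 : (e.1 : Q) ≤ d n := he n
    rw [hds] at h1
    exact h1

/-- Glue the local solutions along a maximal antichain of suitable `b`; a decreasing sequence never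
leaves the piece in which it starts. -/
theorem exists_sigmaClosed_dense {T Q : Type u} [Preorder T] [Preorder Q] {π : T → Q}
    (hπ : IsProjection π) (hT : SigmaClosed T) (hcard : #T ≤ 𝔠) (hsep : SeparativeOrder Q)
    (hatomless : AtomlessOrder Q) : ∃ D : Set Q, IsCoinitial D ∧ SigmaClosed D := by
  obtain ⟨A, hAV, hAeq, hApre⟩ := exists_maximal_antichain
    (U := {b : Q | ∃ D : Set Q, (∀ d ∈ D, d ≤ b) ∧ (∀ q ≤ b, ∃ d ∈ D, d ≤ q) ∧ SigmaClosed D})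
    fun q => by
      obtain ⟨b, hb, h⟩ := exists_sigmaClosed_dense_below hπ hT hcard hsep hatomless q
      exact ⟨b, h, hb⟩
  choose! D hDle hDdense hDclosed using fun (a : Q) (ha : a ∈ A) => hAV ha
  refine ⟨⋃ a ∈ A, D a, fun q => ?_, fun s hs => ?_⟩
  · obtain ⟨a, ha, r, hra, hrq⟩ := hApre q
    obtain ⟨d, hd, hdr⟩ := hDdense a ha r hra
    exact ⟨d, Set.mem_iUnion₂.2 ⟨a, ha, hd⟩, hdr.trans hrq⟩
  · choose a ha hsa using fun n => Set.mem_iUnion₂.1 (s n).2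
    have hs0 : ∀ n, (s n : Q) ∈ D (a 0) := fun n => by
      have h : (s n : Q) ≤ s 0 := hs (Nat.zero_le n)
      rw [hAeq (a 0) (ha 0) (a n) (ha n) (s n) (h.trans (hDle _ (ha 0) _ (hsa 0)))
        (hDle _ (ha n) _ (hsa n))]
      exact hsa n
    obtain ⟨d, hd⟩ := hDclosed _ (ha 0) (fun n => ⟨s n, hs0 n⟩) hs
    exact ⟨⟨d, Set.mem_iUnion₂.2 ⟨a 0, ha 0, d.2⟩⟩, hd⟩

/-- An atomless separative preorder which is a projection of a `σ`-closed preorder of size at most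
continuum has the base tree property. -/
theorem btProperty_of_isProjection {T Q : Type u} [Preorder T] [Preorder Q] {π : T → Q}
    (hπ : IsProjection π) (hT : SigmaClosed T) (hcard : #T ≤ 𝔠) (hsep : SeparativeOrder Q)
    (hatomless : AtomlessOrder Q) : BTProperty Q := by
  obtain ⟨D, hD, hDclosed⟩ := exists_sigmaClosed_dense hπ hT hcard hsep hatomless
  -- One element of `D` below each `π t` still gives a dense set, now of size at most `𝔠`. A dense
  -- subset of the σ-closed `D` is again σ-closed.
  choose d hdD hdt using fun t => hD (π t)
  have hdense : IsCoinitial (Set.range d) := fun q => by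
    obtain ⟨t, ht⟩ := hπ.dense q
    exact ⟨d t, ⟨t, rfl⟩, (hdt t).trans ht⟩
  refine ⟨Set.range d, hdense, fun p => ?_, fun s hs => ?_, Cardinal.mk_range_le.trans hcard⟩
  · obtain ⟨q, r, hq, hr, hinc⟩ := hatomless p
    obtain ⟨q', hq', hqq⟩ := hdense q
    obtain ⟨r', hr', hrr⟩ := hdense r
    refine ⟨⟨q', hq'⟩, ⟨r', hr'⟩, hqq.trans hq, hrr.trans hr, ?_⟩
    rintro ⟨x, h1, h2⟩
    exact hinc ⟨x, le_trans (show (x : Q) ≤ q' from h1) hqq,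
      le_trans (show (x : Q) ≤ r' from h2) hrr⟩
  · have hmem : ∀ n, (s n : Q) ∈ D := fun n => by
      obtain ⟨t, ht⟩ := (s n).2
      exact ht ▸ hdD t
    obtain ⟨e, he⟩ := hDclosed (fun n => ⟨s n, hmem n⟩) hs
    obtain ⟨x, hx, hxe⟩ := hdense e
    refine ⟨⟨x, hx⟩, fun n => ?_⟩
    have h1 : (e : Q) ≤ s n := he n
    exact hxe.trans h1

theorem mainTheorem2 :
    (∀ (P : Type*) [Preorder P] [Nonempty P], BTProperty P →
      ∃ B : BooleanSubalgebra Coll, IsRegularSubalgebra B ∧ Nonempty (RO P ≃o B)) ∧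
    (∀ B : BooleanSubalgebra Coll, IsRegularSubalgebra B → IsCompleteOrder B →
      (∀ a : B, ¬ IsAtom a) → BTProperty (Positive B)) := by
  refine ⟨fun P _ _ hP => exists_regular_embedding_of_btProperty P hP,
    fun B hreg hcompl hatoms => ?_⟩
  obtain ⟨π, hπ⟩ := exists_isProjection_positive hreg hcompl
  exact btProperty_of_isProjection hπ BinTree.sigmaClosed mk_binTree_le
    (separativeOrder_positive B) (atomlessOrder_positive hatoms)
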